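/- For real $a,b,q$ let $f(u,a,b,q)=A_1u^4+B_1u^3+C_1u^2+D_1u+E_1$ with $$A_1=-(q-1)^2(b+q-2)^2(a^2-1)^2,\qquad B_1=(q-1)(b+q-2)^3(a^2-1)^3,$$ $$C_1=-(b+q-2)(a^2-1)\big[(a^2-1)b^3+((q-1)a^4+(2q-5)a^2-5q+8)b^2+((q^2-3q+2)a^4+(2q^2-9q+10)a^2-5q^2+18q-16)b+(q^3-4q^2+8q-6)a^2-q^3+6q^2-12q+8\big],$$ $$D_1=(q+b-2)^2(a^2-1)\big[(a^2+1)b^2+(q-2)(a^2+1)b+a^2(a^2-3)(q-1)\big],$$ $$E_1=-(a^2+1)b^4+(-a^4+(-2q+6)a^2-2q+3)b^3+((-q+4)a^4+(-q^2+12q-18)a^2-q^2+q+2)b^2-(q-2)((q-4)a^4-2(4q-7)a^2+3(q-2))b-(q-1)^2a^6+(-q^3+5q^2-10q+7)a^4+2(q-2)^3a^2-(q-2)^3.$$ (This is the quartic factor that is left when $u_2$ is eliminated from the system $u_1\big[(a^{-1}u_1^2+au_2^2)(q-1)+b(a+a^{-1})\big]=(au_1^2+a^{-1}u_2^2)(q+b-2)+a+a^{-1}$,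 $u_2\big[(a^{-1}u_1^2+au_2^2)(q-1)+b(a+a^{-1})\big]=(a^{-1}u_1^2+au_2^2)(q+b-2)+a+a^{-1}$ for the translation-invariant Gibbs measures of the $(2,q)$-Ising-Potts model, $k=2$, on the invariant set $I_2$.) Then $f(x,a,a,3)=(a-1)^2P(x)$ for all real $a,x$, where $$P(x)=-4(a+1)^4x^4+2(a-1)(a+1)^6x^3-(a+1)^2(2a^5+5a^4+6a^3+6a^2+8a+1)x^2+a(3a^2+4a-1)(a+1)^3x-\big((a+1)^5+a^4+a^2\big).$$ Let $\mathcal N(a)$ be the number of positive roots of $P$, counted with multiplicity. There are real numbers $A^c_1\approx 2.010$ and $A^c_2\approx 4.921$ (decimals truncated: $2.010\le A^c_1<2.011$ and $4.921\le A^c_2<4.922$) such that $$\mathcal N(a)=\begin{cases}0,& a\in(0,A^c_1),\\ 2,& a\in[A^c_1,A^c_2),\\ 4,& a\in[A^c_2,+\infty).\end{cases}$$ Moreover, for every $a>0$ with $a\ne A^c_1$ and $a\neq A^c_2$, the number of distinct positive roots of $P$ is also $\mathcal N(a)$. -/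

import Mathlib

open Polynomial

/-- Coefficient of `u₁⁴` in the quartic `f(u₁, a, b, q)`. -/
def coeffA (a b q : ℝ) : ℝ :=
  -(q - 1) ^ 2 * (b + q - 2) ^ 2 * (a ^ 2 - 1) ^ 2

/-- Coefficient of `u₁³` in the quartic `f(u₁, a, b, q)`. -/
def coeffB (a b q : ℝ) : ℝ :=
  (q - 1) * (b + q - 2) ^ 3 * (a ^ 2 - 1) ^ 3

/-- Coefficient of `u₁²` in the quartic `f(u₁, a, b, q)`. -/
def coeffC (a b q : ℝ) : ℝ :=
  -(b + q - 2) * (a ^ 2 - 1) *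
    ((a ^ 2 - 1) * b ^ 3
      + ((q - 1) * a ^ 4 + (2 * q - 5) * a ^ 2 - 5 * q + 8) * b ^ 2
      + ((q ^ 2 - 3 * q + 2) * a ^ 4 + (2 * q ^ 2 - 9 * q + 10) * a ^ 2
          - 5 * q ^ 2 + 18 * q - 16) * b
      + (q ^ 3 - 4 * q ^ 2 + 8 * q - 6) * a ^ 2 - q ^ 3 + 6 * q ^ 2 - 12 * q + 8)

/-- Coefficient of `u₁` in the quartic `f(u₁, a, b, q)`. The factor `a ^ 2 - 1` occurs to the
first power, as the elimination of `u₂` from the system for `(u₁, u₂)` gives it. -/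
def coeffD (a b q : ℝ) : ℝ :=
  (q + b - 2) ^ 2 * (a ^ 2 - 1) *
    ((a ^ 2 + 1) * b ^ 2 + (q - 2) * (a ^ 2 + 1) * b + a ^ 2 * (a ^ 2 - 3) * (q - 1))

/-- Constant coefficient of the quartic `f(u₁, a, b, q)`. -/
def coeffE (a b q : ℝ) : ℝ :=
  -(a ^ 2 + 1) * b ^ 4 + (-a ^ 4 + (-2 * q + 6) * a ^ 2 - 2 * q + 3) * b ^ 3
    + ((-q + 4) * a ^ 4 + (-q ^ 2 + 12 * q - 18) * a ^ 2 - q ^ 2 + q + 2) * b ^ 2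
    - (q - 2) * ((q - 4) * a ^ 4 - 2 * (4 * q - 7) * a ^ 2 + 3 * (q - 2)) * b
    - (q - 1) ^ 2 * a ^ 6 + (-q ^ 3 + 5 * q ^ 2 - 10 * q + 7) * a ^ 4
    + 2 * (q - 2) ^ 3 * a ^ 2 - (q - 2) ^ 3

/-- The quartic `f(·, a, b, q)`, as a polynomial in its first argument. -/
noncomputable def quarticF (a b q : ℝ) : ℝ[X] :=
  C (coeffA a b q) * X ^ 4 + C (coeffB a b q) * X ^ 3 + C (coeffC a b q) * X ^ 2
    + C (coeffD a b q) * X + C (coeffE a b q)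

/-- The quartic `P`, that is `f(·, a, a, 3)` with the factor `(a - 1) ^ 2` removed. -/
noncomputable def quarticP (a : ℝ) : ℝ[X] :=
  C (-4 * (a + 1) ^ 4) * X ^ 4
    + C (2 * (a - 1) * (a + 1) ^ 6) * X ^ 3
    - C ((a + 1) ^ 2 * (2 * a ^ 5 + 5 * a ^ 4 + 6 * a ^ 3 + 6 * a ^ 2 + 8 * a + 1)) * X ^ 2
    + C (a * (3 * a ^ 2 + 4 * a - 1) * (a + 1) ^ 3) * X
    - C ((a + 1) ^ 5 + a ^ 4 + a ^ 2)

/-- The number of positive roots of a real polynomial, counted with multiplicity. -/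
noncomputable def numPosRoots (p : ℝ[X]) : ℕ :=
  (p.roots.filter (fun x => 0 < x)).card

/-! Put y = (a + 1)x. Then P becomes G(a, y) = `scaledQuartic a y`, of degree only 5 in a, and
positive roots correspond to positive zeros of G(a, ·).

G is strictly increasing in a on two windows: a in [1, 2.02], y ≥ 4, and a in [4.5, 4.93], y in
[1.1, 1.2]. In each window the set of y with G ≥ 0 therefore only grows with a. It is born at a
single value A, where G(A, ·) ≤ 0 touches zero at an interior point, a double root
(`exists_threshold`). These two values are A₁ and A₂. Elsewhere the required signs of G come from
polynomial certificates on boxes.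

Below A₁ this leaves no zeros. Above A₁, G is positive somewhere beyond y = 4 but negative at 0 and
for large y: two zeros. Above A₂, G is also positive somewhere below 9/5 and negative at 9/5: four
zeros, the most a quartic can have. Between the thresholds every positive zero exceeds 9/5, and a
third one would force the Taylor coefficients of G(a, ·) at 9/5 to alternate in sign, which they do
not (`alternating_of_three_pos_roots`, `numPosRoots_quarticP_le_two`). At A₁ and A₂ the double root
supplies the missing unit of multiplicity (`card_lt_numPosRoots`). -/

/-! ### The scaled quartic and its dependence on a -/

/-- The quartic `quarticP a` in the scaled variable `y = (a + 1) * x`. -/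
def scaledQuartic (a y : ℝ) : ℝ :=
  -4 * y ^ 4 + 2 * (a - 1) * (a + 1) ^ 3 * y ^ 3
    - (2 * a ^ 5 + 5 * a ^ 4 + 6 * a ^ 3 + 6 * a ^ 2 + 8 * a + 1) * y ^ 2
    + a * (3 * a ^ 2 + 4 * a - 1) * (a + 1) ^ 2 * y - ((a + 1) ^ 5 + a ^ 4 + a ^ 2)

/-- The derivative of `scaledQuartic a y` with respect to `a`. -/
def scaledQuarticDeriv (a y : ℝ) : ℝ :=
  4 * (2 * a - 1) * (a + 1) ^ 2 * y ^ 3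
    - (10 * a ^ 4 + 20 * a ^ 3 + 18 * a ^ 2 + 12 * a + 8) * y ^ 2
    + (15 * a ^ 4 + 40 * a ^ 3 + 30 * a ^ 2 + 4 * a - 1) * y
    - (5 * (a + 1) ^ 4 + 4 * a ^ 3 + 2 * a)

theorem hasDerivAt_scaledQuartic (a y : ℝ) :
    HasDerivAt (fun a => scaledQuartic a y) (scaledQuarticDeriv a y) a := by
  have hexp : (fun a => scaledQuartic a y) = fun a =>
      (-(2 * y ^ 2) + 3 * y - 1) * a ^ 5 + (2 * y ^ 3 - 5 * y ^ 2 + 10 * y - 6) * a ^ 4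
        + (4 * y ^ 3 - 6 * y ^ 2 + 10 * y - 10) * a ^ 3 + (-(6 * y ^ 2) + 2 * y - 11) * a ^ 2
        + (-(4 * y ^ 3) - 8 * y ^ 2 - y - 5) * a ^ 1
        + (-(4 * y ^ 4) - 2 * y ^ 3 - y ^ 2 - 1) := by
    funext a
    unfold scaledQuartic
    ring
  rw [hexp]
  refine (((((((hasDerivAt_pow 5 a).const_mul _).add ((hasDerivAt_pow 4 a).const_mul _)).add
    ((hasDerivAt_pow 3 a).const_mul _)).add ((hasDerivAt_pow 2 a).const_mul _)).add
    ((hasDerivAt_pow 1 a).const_mul _)).add_const _).congr_deriv ?_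
  unfold scaledQuarticDeriv
  push_cast
  ring

theorem continuous_scaledQuartic : Continuous (Function.uncurry scaledQuartic) := by
  unfold scaledQuartic Function.uncurry
  fun_prop

theorem strictMonoOn_scaledQuartic {y lo hi : ℝ}
    (h : ∀ a ∈ Set.Icc lo hi, 0 < scaledQuarticDeriv a y) :
    StrictMonoOn (fun a => scaledQuartic a y) (Set.Icc lo hi) := by
  refine strictMonoOn_of_deriv_pos (convex_Icc lo hi)
    (fun a _ => (hasDerivAt_scaledQuartic a y).continuousAt.continuousWithinAt) fun a ha => ?_
  rw [(hasDerivAt_scaledQuartic a y).deriv]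
  exact h a (interior_subset ha)

/-! ### Sign certificates on boxes -/

/-- A Bernstein-type certificate, used for every box below. The distances u, v of a and w, z of y to
the ends of their intervals are nonnegative. After a positive constant is split off (`h1`, which
gives strictness), homogenizing in (u, v) and (w, z) leaves only nonnegative coefficients. On an
unbounded range one expands in powers of the distance to the finite end instead. -/
theorem scaledQuartic_neg_of_le_one {a y : ℝ} (ha : a ∈ Set.Icc (0 : ℝ) (1))
    (hy : y ∈ Set.Icc (0 : ℝ) (1)) : scaledQuartic a y < 0 := by
  -- Opaque variables, so that `positivity` sees atoms with known sign rather than differences.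
  obtain ⟨u, hu⟩ : ∃ t, t = a := ⟨_, rfl⟩
  have hu0 : 0 ≤ u := by linarith [ha.1]
  obtain ⟨v, hv⟩ : ∃ t, t = 1 - a := ⟨_, rfl⟩
  have hv0 : 0 ≤ v := by linarith [ha.2]
  obtain ⟨w, hw⟩ : ∃ t, t = y := ⟨_, rfl⟩
  have hw0 : 0 ≤ w := by linarith [hy.1]
  obtain ⟨z, hz⟩ : ∃ t, t = 1 - y := ⟨_, rfl⟩
  have hz0 : 0 ≤ z := by linarith [hy.2]
  have h0 : 0 ≤
      v ^ 5 * w ^ 2 * z ^ 2 + 4 * v ^ 5 * w ^ 3 * z + 7 * v ^ 5 * w ^ 4 + 5 * u * v ^ 4 * z ^ 4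
        + 21 * u * v ^ 4 * w * z ^ 3 + 46 * u * v ^ 4 * w ^ 2 * z ^ 2
        + 63 * u * v ^ 4 * w ^ 3 * z + 53 * u * v ^ 4 * w ^ 4 + 31 * u ^ 2 * v ^ 3 * z ^ 4
        + 126 * u ^ 2 * v ^ 3 * w * z ^ 3 + 240 * u ^ 2 * v ^ 3 * w ^ 2 * z ^ 2
        + 262 * u ^ 2 * v ^ 3 * w ^ 3 * z + 157 * u ^ 2 * v ^ 3 * w ^ 4
        + 73 * u ^ 3 * v ^ 2 * z ^ 4 + 282 * u ^ 3 * v ^ 2 * w * z ^ 3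
        + 490 * u ^ 3 * v ^ 2 * w ^ 2 * z ^ 2 + 466 * u ^ 3 * v ^ 2 * w ^ 3 * z
        + 225 * u ^ 3 * v ^ 2 * w ^ 4 + 79 * u ^ 4 * v * z ^ 4 + 284 * u ^ 4 * v * w * z ^ 3
        + 450 * u ^ 4 * v * w ^ 2 * z ^ 2 + 380 * u ^ 4 * v * w ^ 3 * z + 155 * u ^ 4 * v * w ^ 4
        + 33 * u ^ 5 * z ^ 4 + 108 * u ^ 5 * w * z ^ 3 + 154 * u ^ 5 * w ^ 2 * z ^ 2
        + 116 * u ^ 5 * w ^ 3 * z + 41 * u ^ 5 * w ^ 4 := by positivity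
  simp only [hu, hv, hw, hz] at h0
  have h1 : 0 < (1 : ℝ) := by norm_num
  unfold scaledQuartic
  linear_combination h0 + h1

theorem scaledQuartic_neg_of_le_one_of_one_le {a y : ℝ} (ha : a ∈ Set.Icc (0 : ℝ) (1))
    (hy : 1 ≤ y) : scaledQuartic a y < 0 := by
  obtain ⟨u, hu⟩ : ∃ t, t = a := ⟨_, rfl⟩
  have hu0 : 0 ≤ u := by linarith [ha.1]
  obtain ⟨v, hv⟩ : ∃ t, t = 1 - a := ⟨_, rfl⟩
  have hv0 : 0 ≤ v := by linarith [ha.2]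
  obtain ⟨w, hw⟩ : ∃ t, t = y - 1 := ⟨_, rfl⟩
  have hw0 : 0 ≤ w := by linarith
  have h0 : 0 ≤
      7 * v ^ 5 + 24 * v ^ 5 * w + 31 * v ^ 5 * w ^ 2 + 18 * v ^ 5 * w ^ 3 + 4 * v ^ 5 * w ^ 4
        + 53 * u * v ^ 4 + 149 * u * v ^ 4 * w + 175 * u * v ^ 4 * w ^ 2 + 94 * u * v ^ 4 * w ^ 3
        + 20 * u * v ^ 4 * w ^ 4 + 157 * u ^ 2 * v ^ 3 + 366 * u ^ 2 * v ^ 3 * w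
        + 396 * u ^ 2 * v ^ 3 * w ^ 2 + 196 * u ^ 2 * v ^ 3 * w ^ 3 + 40 * u ^ 2 * v ^ 3 * w ^ 4
        + 225 * u ^ 3 * v ^ 2 + 434 * u ^ 3 * v ^ 2 * w + 442 * u ^ 3 * v ^ 2 * w ^ 2
        + 200 * u ^ 3 * v ^ 2 * w ^ 3 + 40 * u ^ 3 * v ^ 2 * w ^ 4 + 155 * u ^ 4 * v
        + 240 * u ^ 4 * v * w + 240 * u ^ 4 * v * w ^ 2 + 96 * u ^ 4 * v * w ^ 3
        + 20 * u ^ 4 * v * w ^ 4 + 41 * u ^ 5 + 48 * u ^ 5 * w + 52 * u ^ 5 * w ^ 2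
        + 16 * u ^ 5 * w ^ 3 + 4 * u ^ 5 * w ^ 4 := by positivity
  simp only [hu, hv, hw] at h0
  have h1 : 0 < (1 : ℝ) := by norm_num
  unfold scaledQuartic
  linear_combination h0 + h1

theorem scaledQuartic_neg_of_le_two {a y : ℝ} (ha : a ∈ Set.Icc (1 : ℝ) (21 / 10))
    (hy : y ∈ Set.Icc (0 : ℝ) (2)) : scaledQuartic a y < 0 := by
  obtain ⟨u, hu⟩ : ∃ t, t = a - 1 := ⟨_, rfl⟩
  have hu0 : 0 ≤ u := by linarith [ha.1]
  obtain ⟨v, hv⟩ : ∃ t, t = 21 - 10 * a := ⟨_, rfl⟩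
  have hv0 : 0 ≤ v := by linarith [ha.2]
  obtain ⟨w, hw⟩ : ∃ t, t = y := ⟨_, rfl⟩
  have hw0 : 0 ≤ w := by linarith [hy.1]
  obtain ⟨z, hz⟩ : ∃ t, t = 2 - y := ⟨_, rfl⟩
  have hz0 : 0 ≤ z := by linarith [hy.2]
  have h0 : 0 ≤
      24 * v ^ 5 * z ^ 4 + 48 * v ^ 5 * w * z ^ 3 + 112 * v ^ 5 * w ^ 2 * z ^ 2
        + 176 * v ^ 5 * w ^ 3 * z + 152 * v ^ 5 * w ^ 4 + 2146 * u * v ^ 4 * z ^ 4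
        + 4248 * u * v ^ 4 * w * z ^ 3 + 8460 * u * v ^ 4 * w ^ 2 * z ^ 2
        + 11352 * u * v ^ 4 * w ^ 3 * z + 8194 * u * v ^ 4 * w ^ 4
        + 72367 * u ^ 2 * v ^ 3 * z ^ 4 + 134504 * u ^ 2 * v ^ 3 * w * z ^ 3
        + 236806 * u ^ 2 * v ^ 3 * w ^ 2 * z ^ 2 + 280016 * u ^ 2 * v ^ 3 * w ^ 3 * z
        + 169347 * u ^ 2 * v ^ 3 * w ^ 4 + 1181974 * u ^ 3 * v ^ 2 * z ^ 4
        + 1987616 * u ^ 3 * v ^ 2 * w * z ^ 3 + 3105588 * u ^ 3 * v ^ 2 * w ^ 2 * z ^ 2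
        + 3306688 * u ^ 3 * v ^ 2 * w ^ 3 * z + 1646742 * u ^ 3 * v ^ 2 * w ^ 4
        + 9474431 * u ^ 4 * v * z ^ 4 + 13905274 * u ^ 4 * v * w * z ^ 3
        + 18958576 * u ^ 4 * v * w ^ 2 * z ^ 2 + 18707678 * u ^ 4 * v * w ^ 3 * z
        + 7379945 * u ^ 4 * v * w ^ 4 + 30014961 * u ^ 5 * z ^ 4 + 36793038 * u ^ 5 * w * z ^ 3
        + 41788756 * u ^ 5 * w ^ 2 * z ^ 2 + 40826082 * u ^ 5 * w ^ 3 * z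
        + 12215403 * u ^ 5 * w ^ 4 := by positivity
  simp only [hu, hv, hw, hz] at h0
  have h1 : 0 < (10 : ℝ) := by norm_num
  unfold scaledQuartic
  -- Homogenization uses 10u + v = 11 and w + z = 2, and 2576816 = 11⁵ · 2⁴. The factors in the
  -- other boxes arise likewise.
  linear_combination (1 / 2576816) * h0 + h1

theorem scaledQuartic_neg_of_mem_Icc_two_four {a y : ℝ} (ha : a ∈ Set.Icc (1 : ℝ) (101 / 50))
    (hy : y ∈ Set.Icc (2 : ℝ) (4)) : scaledQuartic a y < 0 := by
  obtain ⟨u, hu⟩ : ∃ t, t = a - 1 := ⟨_, rfl⟩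
  have hu0 : 0 ≤ u := by linarith [ha.1]
  obtain ⟨v, hv⟩ : ∃ t, t = 101 - 50 * a := ⟨_, rfl⟩
  have hv0 : 0 ≤ v := by linarith [ha.2]
  obtain ⟨w, hw⟩ : ∃ t, t = y - 2 := ⟨_, rfl⟩
  have hw0 : 0 ≤ w := by linarith [hy.1]
  obtain ⟨z, hz⟩ : ∃ t, t = 4 - y := ⟨_, rfl⟩
  have hz0 : 0 ≤ z := by linarith [hy.2]
  have h0 : 0 ≤
      152 * v ^ 5 * z ^ 4 + 1040 * v ^ 5 * w * z ^ 3 + 2704 * v ^ 5 * w ^ 2 * z ^ 2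
        + 3152 * v ^ 5 * w ^ 3 * z + 1400 * v ^ 5 * w ^ 4 + 40754 * u * v ^ 4 * z ^ 4
        + 270200 * u * v ^ 4 * w * z ^ 3 + 684364 * u * v ^ 4 * w ^ 2 * z ^ 2
        + 778616 * u * v ^ 4 * w ^ 3 * z + 339698 * u * v ^ 4 * w ^ 4
        + 4212947 * u ^ 2 * v ^ 3 * z ^ 4 + 26895560 * u ^ 2 * v ^ 3 * w * z ^ 3
        + 65938318 * u ^ 2 * v ^ 3 * w ^ 2 * z ^ 2 + 72636752 * u ^ 2 * v ^ 3 * w ^ 3 * z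
        + 30981047 * u ^ 2 * v ^ 3 * w ^ 4 + 206917822 * u ^ 3 * v ^ 2 * z ^ 4
        + 1255865008 * u ^ 3 * v ^ 2 * w * z ^ 3 + 2937370388 * u ^ 3 * v ^ 2 * w ^ 2 * z ^ 2
        + 3069253744 * u ^ 3 * v ^ 2 * w ^ 3 * z + 1260830542 * u ^ 3 * v ^ 2 * w ^ 4
        + 4755505705 * u ^ 4 * v * z ^ 4 + 26753939242 * u ^ 4 * v * w * z ^ 3
        + 57612295508 * u ^ 4 * v * w ^ 2 * z ^ 2 + 53593663294 * u ^ 4 * v * w ^ 3 * z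
        + 19979801323 * u ^ 4 * v * w ^ 4 + 40921681003 * u ^ 5 * z ^ 4
        + 203819997622 * u ^ 5 * w * z ^ 3 + 366524969456 * u ^ 5 * w ^ 2 * z ^ 2
        + 224804269258 * u ^ 5 * w ^ 3 * z + 41177616421 * u ^ 5 * w ^ 4 := by positivity
  simp only [hu, hv, hw, hz] at h0
  have h1 : 0 < (10 : ℝ) := by norm_num
  unfold scaledQuartic
  linear_combination (1 / 5520404016) * h0 + h1

theorem scaledQuartic_neg_of_ten_le {a y : ℝ} (ha : a ∈ Set.Icc (1 : ℝ) (101 / 50))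
    (hy : 10 ≤ y) : scaledQuartic a y < 0 := by
  obtain ⟨u, hu⟩ : ∃ t, t = a - 1 := ⟨_, rfl⟩
  have hu0 : 0 ≤ u := by linarith [ha.1]
  obtain ⟨v, hv⟩ : ∃ t, t = 101 - 50 * a := ⟨_, rfl⟩
  have hv0 : 0 ≤ v := by linarith [ha.2]
  obtain ⟨w, hw⟩ : ∃ t, t = y - 10 := ⟨_, rfl⟩
  have hw0 : 0 ≤ w := by linarith
  have h0 : 0 ≤
      42584 * v ^ 5 + 16536 * v ^ 5 * w + 2428 * v ^ 5 * w ^ 2 + 160 * v ^ 5 * w ^ 3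
        + 4 * v ^ 5 * w ^ 4 + 10136306 * u * v ^ 4 + 3954072 * u * v ^ 4 * w
        + 585988 * u * v ^ 4 * w ^ 2 + 39184 * u * v ^ 4 * w ^ 3 + 1000 * u * v ^ 4 * w ^ 4
        + 916537667 * u ^ 2 * v ^ 3 + 362219358 * u ^ 2 * v ^ 3 * w
        + 54817354 * u ^ 2 * v ^ 3 * w ^ 2 + 3774376 * u ^ 2 * v ^ 3 * w ^ 3
        + 100000 * u ^ 2 * v ^ 3 * w ^ 4 + 37584158494 * u ^ 3 * v ^ 2
        + 15325706940 * u ^ 3 * v ^ 2 * w + 2426130686 * u ^ 3 * v ^ 2 * w ^ 2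
        + 176804588 * u ^ 3 * v ^ 2 * w ^ 3 + 5000000 * u ^ 3 * v ^ 2 * w ^ 4
        + 616786863361 * u ^ 4 * v + 274012818675 * u ^ 4 * v * w
        + 48297479555 * u ^ 4 * v * w ^ 2 + 3951108398 * u ^ 4 * v * w ^ 3
        + 125000000 * u ^ 4 * v * w ^ 4 + 1460742125971 * u ^ 5 + 1131109268037 * u ^ 5 * w
        + 298731563252 * u ^ 5 * w ^ 2 + 32440949900 * u ^ 5 * w ^ 3 + 1250000000 * u ^ 5 * w ^ 4 := by positivity
  simp only [hu, hv, hw] at h0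
  have h1 : 0 < (10 : ℝ) := by norm_num
  unfold scaledQuartic
  linear_combination (1 / 345025251) * h0 + h1

theorem scaledQuarticDeriv_pos_of_four_le {a y : ℝ} (ha : a ∈ Set.Icc (1 : ℝ) (101 / 50))
    (hy : 4 ≤ y) : 0 < scaledQuarticDeriv a y := by
  obtain ⟨u, hu⟩ : ∃ t, t = a - 1 := ⟨_, rfl⟩
  have hu0 : 0 ≤ u := by linarith [ha.1]
  obtain ⟨v, hv⟩ : ∃ t, t = 101 - 50 * a := ⟨_, rfl⟩
  have hv0 : 0 ≤ v := by linarith [ha.2]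
  obtain ⟨w, hw⟩ : ∃ t, t = y - 4 := ⟨_, rfl⟩
  have hw0 : 0 ≤ w := by linarith
  have h0 : 0 ≤
      192 * v ^ 4 + 312 * v ^ 4 * w + 124 * v ^ 4 * w ^ 2 + 16 * v ^ 4 * w ^ 3
        + 115206 * u * v ^ 3 + 131964 * u * v ^ 3 * w + 46628 * u * v ^ 3 * w ^ 2
        + 5648 * u * v ^ 3 * w ^ 3 + 16804224 * u ^ 2 * v ^ 2 + 17361864 * u ^ 2 * v ^ 2 * w
        + 5898894 * u ^ 2 * v ^ 2 * w ^ 2 + 700836 * u ^ 2 * v ^ 2 * w ^ 3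
        + 900173508 * u ^ 3 * v + 902987004 * u ^ 3 * v * w + 306954836 * u ^ 3 * v * w ^ 2
        + 36784808 * u ^ 3 * v * w ^ 3 + 15488519295 * u ^ 4 + 15850452135 * u ^ 4 * w
        + 5586354790 * u ^ 4 * w ^ 2 + 693150400 * u ^ 4 * w ^ 3 := by positivity
  simp only [hu, hv, hw] at h0
  have h1 : 0 < (10 : ℝ) := by norm_num
  unfold scaledQuarticDeriv
  linear_combination (1 / 6765201) * h0 + h1

theorem scaledQuartic_neg_of_le_eleven_tenths {a y : ℝ} (ha : a ∈ Set.Icc (2 : ℝ) (493 / 100))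
    (hy : y ∈ Set.Icc (0 : ℝ) (11 / 10)) : scaledQuartic a y < 0 := by
  obtain ⟨u, hu⟩ : ∃ t, t = a - 2 := ⟨_, rfl⟩
  have hu0 : 0 ≤ u := by linarith [ha.1]
  obtain ⟨v, hv⟩ : ∃ t, t = 493 - 100 * a := ⟨_, rfl⟩
  have hv0 : 0 ≤ v := by linarith [ha.2]
  obtain ⟨w, hw⟩ : ∃ t, t = y := ⟨_, rfl⟩
  have hw0 : 0 ≤ w := by linarith [hy.1]
  obtain ⟨z, hz⟩ : ∃ t, t = 11 - 10 * y := ⟨_, rfl⟩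
  have hz0 : 0 ≤ z := by linarith [hy.2]
  have h0 : 0 ≤
      253 * v ^ 5 * z ^ 4 + 6358 * v ^ 5 * w * z ^ 3 + 67133 * v ^ 5 * w ^ 2 * z ^ 2
        + 375386 * v ^ 5 * w ^ 3 * z + 927124 * v ^ 5 * w ^ 4 + 255713 * u * v ^ 4 * z ^ 4
        + 6133319 * u * v ^ 4 * w * z ^ 3 + 59700342 * u * v ^ 4 * w ^ 2 * z ^ 2
        + 298807976 * u * v ^ 4 * w ^ 3 * z + 623516560 * u * v ^ 4 * w ^ 4
        + 102310655 * u ^ 2 * v ^ 3 * z ^ 4 + 2318714062 * u ^ 2 * v ^ 3 * w * z ^ 3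
        + 20352006398 * u ^ 2 * v ^ 3 * w ^ 2 * z ^ 2 + 88406782392 * u ^ 2 * v ^ 3 * w ^ 3 * z
        + 150331096120 * u ^ 2 * v ^ 3 * w ^ 4 + 20345484686 * u ^ 3 * v ^ 2 * z ^ 4
        + 431692627370 * u ^ 3 * v ^ 2 * w * z ^ 3
        + 3314291130122 * u ^ 3 * v ^ 2 * w ^ 2 * z ^ 2
        + 11776425873700 * u ^ 3 * v ^ 2 * w ^ 3 * z + 15158566234800 * u ^ 3 * v ^ 2 * w ^ 4
        + 2014050100016 * u ^ 4 * v * z ^ 4 + 39605389774200 * u ^ 4 * v * w * z ^ 3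
        + 253295122873825 * u ^ 4 * v * w ^ 2 * z ^ 2 + 635726150740238 * u ^ 4 * v * w ^ 3 * z
        + 521919994059880 * u ^ 4 * v * w ^ 4 + 79378943026293 * u ^ 5 * z ^ 4
        + 1427690839912851 * u ^ 5 * w * z ^ 3 + 6920308301227936 * u ^ 5 * w ^ 2 * z ^ 2
        + 5799210751249220 * u ^ 5 * w ^ 3 * z + 448327039619600 * u ^ 5 * w ^ 4 := by positivity
  simp only [hu, hv, hw, hz] at h0
  have h1 : 0 < (10 : ℝ) := by norm_num
  unfold scaledQuartic
  linear_combination (1 / 31616139736790213) * h0 + h1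

theorem scaledQuartic_neg_of_le_six_fifths {a y : ℝ} (ha : a ∈ Set.Icc (2 : ℝ) (9 / 2))
    (hy : y ∈ Set.Icc (11 / 10 : ℝ) (6 / 5)) : scaledQuartic a y < 0 := by
  obtain ⟨u, hu⟩ : ∃ t, t = a - 2 := ⟨_, rfl⟩
  have hu0 : 0 ≤ u := by linarith [ha.1]
  obtain ⟨v, hv⟩ : ∃ t, t = 9 - 2 * a := ⟨_, rfl⟩
  have hv0 : 0 ≤ v := by linarith [ha.2]
  obtain ⟨w, hw⟩ : ∃ t, t = 10 * y - 11 := ⟨_, rfl⟩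
  have hw0 : 0 ≤ w := by linarith [hy.1]
  obtain ⟨z, hz⟩ : ∃ t, t = 6 - 5 * y := ⟨_, rfl⟩
  have hz0 : 0 ≤ z := by linarith [hy.2]
  have h0 : 0 ≤
      927124 * v ^ 5 * z ^ 4 + 1852186 * v ^ 5 * w * z ^ 3 + 1389689 * v ^ 5 * w ^ 2 * z ^ 2
        + 464066 * v ^ 5 * w ^ 3 * z + 58189 * v ^ 5 * w ^ 4 + 12000840 * u * v ^ 4 * z ^ 4
        + 23615460 * u * v ^ 4 * w * z ^ 3 + 17451340 * u * v ^ 4 * w ^ 2 * z ^ 2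
        + 5739035 * u * v ^ 4 * w ^ 3 * z + 708565 * u * v ^ 4 * w ^ 4
        + 57068760 * u ^ 2 * v ^ 3 * z ^ 4 + 109943240 * u ^ 2 * v ^ 3 * w * z ^ 3
        + 79515910 * u ^ 2 * v ^ 3 * w ^ 2 * z ^ 2 + 25583390 * u ^ 2 * v ^ 3 * w ^ 3 * z
        + 3088835 * u ^ 2 * v ^ 3 * w ^ 4 + 119612320 * u ^ 3 * v ^ 2 * z ^ 4
        + 222825780 * u ^ 3 * v ^ 2 * w * z ^ 3 + 155694670 * u ^ 3 * v ^ 2 * w ^ 2 * z ^ 2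
        + 48345030 * u ^ 3 * v ^ 2 * w ^ 3 * z + 5626320 * u ^ 3 * v ^ 2 * w ^ 4
        + 100906120 * u ^ 4 * v * z ^ 4 + 176772830 * u ^ 4 * v * w * z ^ 3
        + 115908645 * u ^ 4 * v * w ^ 2 * z ^ 2 + 33715780 * u ^ 4 * v * w ^ 3 * z
        + 3670720 * u ^ 4 * v * w ^ 4 + 21317568 * u ^ 5 * z ^ 4 + 32898552 * u ^ 5 * w * z ^ 3
        + 19476998 * u ^ 5 * w ^ 2 * z ^ 2 + 5415987 * u ^ 5 * w ^ 3 * z + 618723 * u ^ 5 * w ^ 4 := by positivity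
  simp only [hu, hv, hw, hz] at h0
  have h1 : 0 < (10 : ℝ) := by norm_num
  unfold scaledQuartic
  linear_combination (1 / 1953125) * h0 + h1

theorem scaledQuartic_neg_of_le_nine_fifths {a y : ℝ} (ha : a ∈ Set.Icc (2 : ℝ) (37 / 10))
    (hy : y ∈ Set.Icc (6 / 5 : ℝ) (9 / 5)) : scaledQuartic a y < 0 := by
  obtain ⟨u, hu⟩ : ∃ t, t = a - 2 := ⟨_, rfl⟩
  have hu0 : 0 ≤ u := by linarith [ha.1]
  obtain ⟨v, hv⟩ : ∃ t, t = 37 - 10 * a := ⟨_, rfl⟩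
  have hv0 : 0 ≤ v := by linarith [ha.2]
  obtain ⟨w, hw⟩ : ∃ t, t = 5 * y - 6 := ⟨_, rfl⟩
  have hw0 : 0 ≤ w := by linarith [hy.1]
  obtain ⟨z, hz⟩ : ∃ t, t = 9 - 5 * y := ⟨_, rfl⟩
  have hz0 : 0 ≤ z := by linarith [hy.2]
  have h0 : 0 ≤
      63814 * v ^ 5 * z ^ 4 + 259594 * v ^ 5 * w * z ^ 3 + 412359 * v ^ 5 * w ^ 2 * z ^ 2
        + 296494 * v ^ 5 * w ^ 3 * z + 80239 * v ^ 5 * w ^ 4 + 3621395 * u * v ^ 4 * z ^ 4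
        + 13835735 * u * v ^ 4 * w * z ^ 3 + 20736525 * u * v ^ 4 * w ^ 2 * z ^ 2
        + 13968665 * u * v ^ 4 * w ^ 3 * z + 3462680 * u * v ^ 4 * w ^ 4
        + 78127235 * u ^ 2 * v ^ 3 * z ^ 4 + 273481130 * u ^ 2 * v ^ 3 * w * z ^ 3
        + 377610150 * u ^ 2 * v ^ 3 * w ^ 2 * z ^ 2 + 229864370 * u ^ 2 * v ^ 3 * w ^ 3 * z
        + 47932115 * u ^ 2 * v ^ 3 * w ^ 4 + 787257200 * u ^ 3 * v ^ 2 * z ^ 4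
        + 2422535750 * u ^ 3 * v ^ 2 * w * z ^ 3 + 2971658100 * u ^ 3 * v ^ 2 * w ^ 2 * z ^ 2
        + 1531504250 * u ^ 3 * v ^ 2 * w ^ 3 * z + 198364700 * u ^ 3 * v ^ 2 * w ^ 4
        + 3630250640 * u ^ 4 * v * z ^ 4 + 9239004020 * u ^ 4 * v * w * z ^ 3
        + 10050549825 * u ^ 4 * v * w ^ 2 * z ^ 2 + 4548173480 * u ^ 4 * v * w ^ 3 * z
        + 122577035 * u ^ 4 * v * w ^ 4 + 6119946375 * u ^ 5 * z ^ 4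
        + 13171948575 * u ^ 5 * w * z ^ 3 + 19825484175 * u ^ 5 * w ^ 2 * z ^ 2
        + 17305411425 * u ^ 5 * w ^ 3 * z + 4564329450 * u ^ 5 * w ^ 4 := by positivity
  simp only [hu, hv, hw, hz] at h0
  have h1 : 0 < (1 : ℝ) := by norm_num
  unfold scaledQuartic
  linear_combination (1 / 71880260625) * h0 + h1

theorem scaledQuartic_neg_of_le_nine_fifths' {a y : ℝ} (ha : a ∈ Set.Icc (37 / 10 : ℝ) (493 / 100))
    (hy : y ∈ Set.Icc (6 / 5 : ℝ) (9 / 5)) : scaledQuartic a y < 0 := by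
  obtain ⟨u, hu⟩ : ∃ t, t = 10 * a - 37 := ⟨_, rfl⟩
  have hu0 : 0 ≤ u := by linarith [ha.1]
  obtain ⟨v, hv⟩ : ∃ t, t = 493 - 100 * a := ⟨_, rfl⟩
  have hv0 : 0 ≤ v := by linarith [ha.2]
  obtain ⟨w, hw⟩ : ∃ t, t = 5 * y - 6 := ⟨_, rfl⟩
  have hw0 : 0 ≤ w := by linarith [hy.1]
  obtain ⟨z, hz⟩ : ∃ t, t = 9 - 5 * y := ⟨_, rfl⟩
  have hz0 : 0 ≤ z := by linarith [hy.2]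
  have h0 : 0 ≤
      81599285 * v ^ 5 * z ^ 4 + 175625981 * v ^ 5 * w * z ^ 3
        + 264339789 * v ^ 5 * w ^ 2 * z ^ 2 + 230738819 * v ^ 5 * w ^ 3 * z
        + 60857726 * v ^ 5 * w ^ 4 + 3529814237 * u * v ^ 4 * z ^ 4
        + 6221905661 * u * v ^ 4 * w * z ^ 3 + 13084045515 * u * v ^ 4 * w ^ 2 * z ^ 2
        + 15496607339 * u * v ^ 4 * w ^ 3 * z + 5126253248 * u * v ^ 4 * w ^ 4
        + 55904501442 * u ^ 2 * v ^ 3 * z ^ 4 + 76330419066 * u ^ 2 * v ^ 3 * w * z ^ 3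
        + 324213649050 * u ^ 2 * v ^ 3 * w ^ 2 * z ^ 2 + 489830240934 * u ^ 2 * v ^ 3 * w ^ 3 * z
        + 186474509508 * u ^ 2 * v ^ 3 * w ^ 4 + 382483086002 * u ^ 3 * v ^ 2 * z ^ 4
        + 467861803826 * u ^ 3 * v ^ 2 * w * z ^ 3
        + 5070401379870 * u ^ 3 * v ^ 2 * w ^ 2 * z ^ 2
        + 8359595630174 * u ^ 3 * v ^ 2 * w ^ 3 * z + 3378892968128 * u ^ 3 * v ^ 2 * w ^ 4
        + 973376030297 * u ^ 4 * v * z ^ 4 + 3092628022601 * u ^ 4 * v * w * z ^ 3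
        + 44752033092105 * u ^ 4 * v * w ^ 2 * z ^ 2 + 72300409973399 * u ^ 4 * v * w ^ 3 * z
        + 29689228873598 * u ^ 4 * v * w ^ 4 + 317429740737 * u ^ 5 * z ^ 4
        + 16330199774865 * u ^ 5 * w * z ^ 3 + 161610559405671 * u ^ 5 * w ^ 2 * z ^ 2
        + 246343317241335 * u ^ 5 * w ^ 3 * z + 100788727869792 * u ^ 5 * w ^ 4 := by positivity
  simp only [hu, hv, hw, hz] at h0
  have h1 : 0 < (1 : ℝ) := by norm_num
  unfold scaledQuartic
  linear_combination (1 / 1900331336902500000) * h0 + h1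

theorem scaledQuarticDeriv_pos_of_mem_Icc {a y : ℝ} (ha : a ∈ Set.Icc (9 / 2 : ℝ) (493 / 100))
    (hy : y ∈ Set.Icc (11 / 10 : ℝ) (6 / 5)) : 0 < scaledQuarticDeriv a y := by
  obtain ⟨u, hu⟩ : ∃ t, t = 2 * a - 9 := ⟨_, rfl⟩
  have hu0 : 0 ≤ u := by linarith [ha.1]
  obtain ⟨v, hv⟩ : ∃ t, t = 493 - 100 * a := ⟨_, rfl⟩
  have hv0 : 0 ≤ v := by linarith [ha.2]
  obtain ⟨w, hw⟩ : ∃ t, t = 10 * y - 11 := ⟨_, rfl⟩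
  have hw0 : 0 ≤ w := by linarith [hy.1]
  obtain ⟨z, hz⟩ : ∃ t, t = 6 - 5 * y := ⟨_, rfl⟩
  have hz0 : 0 ≤ z := by linarith [hy.2]
  have h0 : 0 ≤
      1744488 * v ^ 4 * z ^ 3 + 2588814 * v ^ 4 * w * z ^ 2 + 1154239 * v ^ 4 * w ^ 2 * z
        + 149913 * v ^ 4 * w ^ 3 + 388672256 * u * v ^ 3 * z ^ 3
        + 564575008 * u * v ^ 3 * w * z ^ 2 + 245185548 * u * v ^ 3 * w ^ 2 * z
        + 30445796 * u * v ^ 3 * w ^ 3 + 32217389040 * u ^ 2 * v ^ 2 * z ^ 3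
        + 45802897860 * u ^ 2 * v ^ 2 * w * z ^ 2 + 19329732450 * u ^ 2 * v ^ 2 * w ^ 2 * z
        + 2274297630 * u ^ 2 * v ^ 2 * w ^ 3 + 1178248955072 * u ^ 3 * v * z ^ 3
        + 1638543479936 * u ^ 3 * v * w * z ^ 2 + 669810398556 * u ^ 3 * v * w ^ 2 * z
        + 73721266692 * u ^ 3 * v * w ^ 3 + 16047905873000 * u ^ 4 * z ^ 3
        + 21807444345550 * u ^ 4 * w * z ^ 2 + 8597568041975 * u ^ 4 * w ^ 2 * z
        + 868489219425 * u ^ 4 * w ^ 3 := by positivity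
  simp only [hu, hv, hw, hz] at h0
  have h1 : 0 < (10 : ℝ) := by norm_num
  unfold scaledQuarticDeriv
  linear_combination (1 / 6837602000) * h0 + h1

/-- The point 9/5 separates the two small zeros from the two large ones once a passes A₂. -/
theorem scaledQuartic_nine_fifths_neg {a : ℝ} (ha : 9 / 2 ≤ a) : scaledQuartic a (9 / 5) < 0 := by
  obtain ⟨u, hu⟩ : ∃ t, t = 2 * a - 9 := ⟨_, rfl⟩
  have hu0 : 0 ≤ u := by linarith
  have h0 : 0 ≤
      5378049 + 5597170 * u + 2137190 * u ^ 2 + 343700 * u ^ 3 + 24585 * u ^ 4 + 650 * u ^ 5 := by positivity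
  simp only [hu] at h0
  have h1 : 0 < (10 : ℝ) := by norm_num
  unfold scaledQuartic
  linear_combination (1 / 10000) * h0 + h1

theorem scaledQuartic_six_pos {a : ℝ} (ha : a ∈ Set.Icc (2011 / 1000 : ℝ) (6)) : 0 < scaledQuartic a 6 := by
  obtain ⟨u, hu⟩ : ∃ t, t = 1000 * a - 2011 := ⟨_, rfl⟩
  have hu0 : 0 ≤ u := by linarith [ha.1]
  obtain ⟨v, hv⟩ : ∃ t, t = 6 - a := ⟨_, rfl⟩
  have hv0 : 0 ≤ v := by linarith [ha.2]
  have h0 : 0 ≤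
      1033212544738195 * v ^ 5 + 47464357765350496 * u * v ^ 4 + 300405154101102 * u ^ 2 * v ^ 3
        + 675799857045 * u ^ 3 * v ^ 2 + 577690875 * u ^ 4 * v + 99283 * u ^ 5 := by positivity
  simp only [hu, hv] at h0
  have h1 : 0 < (10 : ℝ) := by norm_num
  unfold scaledQuartic
  linear_combination (1 / 1009997227332658949) * h0 + h1

theorem scaledQuartic_self_pos {a : ℝ} (ha : 6 ≤ a) : 0 < scaledQuartic a a := by
  obtain ⟨u, hu⟩ : ∃ t, t = a - 6 := ⟨_, rfl⟩
  have hu0 : 0 ≤ u := by linarith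
  have h0 : 0 ≤
      99283 + 102007 * u + 42863 * u ^ 2 + 9462 * u ^ 3 + 1160 * u ^ 4 + 75 * u ^ 5 + 2 * u ^ 6 := by positivity
  simp only [hu] at h0
  have h1 : 0 < (10 : ℝ) := by norm_num
  unfold scaledQuartic
  linear_combination h0 + h1

theorem scaledQuartic_pos_of_le_six {a : ℝ} (ha : a ∈ Set.Icc (2461 / 500 : ℝ) (6)) : 0 < scaledQuartic a (29 / 25) := by
  obtain ⟨u, hu⟩ : ∃ t, t = 500 * a - 2461 := ⟨_, rfl⟩
  have hu0 : 0 ≤ u := by linarith [ha.1]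
  obtain ⟨v, hv⟩ : ∃ t, t = 6 - a := ⟨_, rfl⟩
  have hv0 : 0 ≤ v := by linarith [ha.2]
  have h0 : 0 ≤
      260636707384320000 * v ^ 5 + 13307862532995047300 * u * v ^ 4
        + 110497997810361800 * u ^ 2 * v ^ 3 + 337678626970100 * u ^ 3 * v ^ 2
        + 447189134900 * u ^ 4 * v + 214249879 * u ^ 5 := by positivity
  simp only [hu, hv] at h0
  have h1 : 0 < (1/100 : ℝ) := by norm_num
  unfold scaledQuartic
  linear_combination (1 / 71082689572967187500) * h0 + h1

theorem scaledQuartic_one_pos {a : ℝ} (ha : 6 ≤ a) : 0 < scaledQuartic a 1 := by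
  obtain ⟨u, hu⟩ : ∃ t, t = a - 6 := ⟨_, rfl⟩
  have hu0 : 0 ≤ u := by linarith
  have h0 : 0 ≤
      198 + 450 * u + 165 * u ^ 2 + 22 * u ^ 3 + u ^ 4 := by positivity
  simp only [hu] at h0
  have h1 : 0 < (10 : ℝ) := by norm_num
  unfold scaledQuartic
  linear_combination h0 + h1

/-! ### Taylor coefficients at 9/5 -/

/-- The coefficients of `z`, `z ^ 2`, `z ^ 3` in `scaledQuartic a (9 / 5 + z)`. -/
noncomputable def shiftedLinearCoeff (a : ℝ) : ℝ :=
  -21 / 5 * a ^ 5 + 286 / 25 * a ^ 4 + 682 / 25 * a ^ 3 - 98 / 5 * a ^ 2 - 1717 / 25 * a - 14544 / 125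

noncomputable def shiftedQuadraticCoeff (a : ℝ) : ℝ :=
  -2 * a ^ 5 + 29 / 5 * a ^ 4 + 78 / 5 * a ^ 3 - 6 * a ^ 2 - 148 / 5 * a - 2239 / 25

noncomputable def shiftedCubicCoeff (a : ℝ) : ℝ :=
  2 * a ^ 4 + 4 * a ^ 3 - 4 * a - 154 / 5

theorem shiftedLinearCoeff_neg_of_le {a : ℝ} (ha : a ∈ Set.Icc (2 : ℝ) (11 / 5)) : shiftedLinearCoeff a < 0 := by
  obtain ⟨u, hu⟩ : ∃ t, t = a - 2 := ⟨_, rfl⟩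
  have hu0 : 0 ≤ u := by linarith [ha.1]
  obtain ⟨v, hv⟩ : ∃ t, t = 11 - 5 * a := ⟨_, rfl⟩
  have hv0 : 0 ≤ v := by linarith [ha.2]
  have h0 : 0 ≤
      6904 * v ^ 5 + 146305 * u * v ^ 4 + 1189770 * u ^ 2 * v ^ 3 + 4536950 * u ^ 3 * v ^ 2
        + 7718070 * u ^ 4 * v + 4022750 * u ^ 5 := by positivity
  simp only [hu, hv] at h0
  have h1 : 0 < (10 : ℝ) := by norm_num
  unfold shiftedLinearCoeff
  linear_combination (1 / 125) * h0 + h1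

theorem shiftedQuadraticCoeff_pos {a : ℝ} (ha : a ∈ Set.Icc (11 / 5 : ℝ) (37 / 10)) : 0 < shiftedQuadraticCoeff a := by
  obtain ⟨u, hu⟩ : ∃ t, t = 5 * a - 11 := ⟨_, rfl⟩
  have hu0 : 0 ≤ u := by linarith [ha.1]
  obtain ⟨v, hv⟩ : ∃ t, t = 37 - 10 * a := ⟨_, rfl⟩
  have hv0 : 0 ≤ v := by linarith [ha.2]
  have h0 : 0 ≤
      16202 * v ^ 5 + 1880360 * u * v ^ 4 + 15869450 * u ^ 2 * v ^ 3 + 48839470 * u ^ 3 * v ^ 2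
        + 59699215 * u ^ 4 * v + 19910104 * u ^ 5 := by positivity
  simp only [hu, hv] at h0
  have h1 : 0 < (10 : ℝ) := by norm_num
  unfold shiftedQuadraticCoeff
  linear_combination (1 / 2373046875) * h0 + h1

theorem shiftedLinearCoeff_neg_of_ge {a : ℝ} (ha : a ∈ Set.Icc (37 / 10 : ℝ) (493 / 100)) : shiftedLinearCoeff a < 0 := by
  obtain ⟨u, hu⟩ : ∃ t, t = 10 * a - 37 := ⟨_, rfl⟩
  have hu0 : 0 ≤ u := by linarith [ha.1]
  obtain ⟨v, hv⟩ : ∃ t, t = 493 - 100 * a := ⟨_, rfl⟩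
  have hv0 : 0 ≤ v := by linarith [ha.2]
  have h0 : 0 ≤
      7692085 * v ^ 5 + 4758405653 * u * v ^ 4 + 251067797098 * u ^ 2 * v ^ 3
        + 5105976242338 * u ^ 3 * v ^ 2 + 46206505520993 * u ^ 4 * v + 156311594237833 * u ^ 5 := by positivity
  simp only [hu, hv] at h0
  have h1 : 0 < (10 : ℝ) := by norm_num
  unfold shiftedLinearCoeff
  linear_combination (1 / 14076528421500000) * h0 + h1
-- The two thresholds
theorem scaledQuartic_two_point_zero_one_neg {y : ℝ} (hy : y ∈ Set.Icc (4 : ℝ) 10) :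
    scaledQuartic (2.01) y < 0 := by
  -- Just below the threshold -G is nearly a square times a positive quadratic: 5.977 approximates
  -- the local maximizer of G(2.01, ·), and the second factor approximates the quotient.
  have h0 : 0 ≤ (y - 5.977) ^ 2 * (4 * (y - 0.9) ^ 2 + 4) := by positivity
  obtain ⟨h1, h2⟩ := hy
  unfold scaledQuartic
  nlinarith [mul_nonneg (sq_nonneg (y - 5.977)) (sub_nonneg.2 h1), sq_nonneg (y - 5.977)]

theorem scaledQuartic_four_point_nine_two_one_neg {y : ℝ} (hy : y ∈ Set.Icc (1.1 : ℝ) 1.2) :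
    scaledQuartic (4.921) y < 0 := by
  obtain ⟨h1, h2⟩ := hy
  unfold scaledQuartic
  -- 1.1626 approximates the local maximizer of G(4.921, ·).
  nlinarith [mul_nonneg (sq_nonneg (y - 1.1626)) (sub_nonneg.2 h2),
    mul_nonneg (sq_nonneg (y - 1.1626)) (sq_nonneg y), sq_nonneg (y - 1.1626)]

/-- The region `{y ∈ [c, d] | 0 ≤ F a y}` grows with `a`; it appears at some `a = A`, where it
consists of zeros of `F A`. -/
theorem exists_threshold {F : ℝ → ℝ → ℝ} (hF : Continuous (Function.uncurry F))
    {lo mid hi c d y₁ : ℝ} (hmid : mid ∈ Set.Icc lo hi) (hy₁ : y₁ ∈ Set.Icc c d)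
    (hmono : ∀ y ∈ Set.Icc c d, StrictMonoOn (fun a => F a y) (Set.Icc lo hi))
    (hneg : ∀ y ∈ Set.Icc c d, F mid y < 0)
    (hc : ∀ a ∈ Set.Icc lo hi, F a c < 0) (hd : ∀ a ∈ Set.Icc lo hi, F a d < 0)
    (hpos : 0 < F hi y₁) :
    ∃ A ∈ Set.Ioo mid hi, ∃ y ∈ Set.Ioo c d, F A y = 0 ∧ (∀ z ∈ Set.Icc c d, F A z ≤ 0) ∧
      (∀ a ∈ Set.Ico lo A, ∀ z ∈ Set.Icc c d, F a z < 0) ∧ ∀ a ∈ Set.Ioc A hi, 0 < F a y := by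
  have hcont : ∀ y, Continuous fun a => F a y := fun y =>
    hF.comp (continuous_id.prodMk continuous_const)
  have hlohi : lo ≤ hi := hmid.1.trans hmid.2
  have hlt : ∀ a ∈ Set.Icc lo hi, a ≤ mid → ∀ y ∈ Set.Icc c d, F a y < 0 := fun a ha hle y hy =>
    ((hmono y hy).monotoneOn ha hmid hle).trans_lt (hneg y hy)
  let S : Set (ℝ × ℝ) := (Set.Icc lo hi ×ˢ Set.Icc c d) ∩ {p | 0 ≤ F p.1 p.2}
  have hS : IsCompact S :=
    (isCompact_Icc.prod isCompact_Icc).inter_right (isClosed_le continuous_const hF)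
  -- A is the least parameter at which the compact set S has a point.
  obtain ⟨⟨A, y⟩, ⟨⟨hA, hy⟩, hAy⟩, hmin⟩ :=
    hS.exists_isMinOn ⟨(hi, y₁), ⟨⟨hlohi, le_rfl⟩, hy₁⟩, hpos.le⟩ continuous_fst.continuousOn
  simp only at hA hy
  change 0 ≤ F A y at hAy
  have hle : ∀ a ∈ Set.Icc lo hi, ∀ z ∈ Set.Icc c d, 0 ≤ F a z → A ≤ a := fun a ha z hz h =>
    hmin (show (a, z) ∈ S from ⟨⟨ha, hz⟩, h⟩)
  have hmidA : mid < A := by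
    by_contra! h
    exact (hlt A hA h y hy).not_ge hAy
  have hnonpos : ∀ z ∈ Set.Icc c d, F A z ≤ 0 := by
    intro z hz
    by_contra! h
    -- A positive value at A would produce a zero at an earlier parameter, against minimality.
    obtain ⟨a, ha, ha0⟩ := intermediate_value_Ioo hmidA.le (hcont z).continuousOn
      (show (0 : ℝ) ∈ Set.Ioo _ _ from ⟨hneg z hz, h⟩)
    have := hle a ⟨hmid.1.trans ha.1.le, ha.2.le.trans hA.2⟩ z hz (le_of_eq ha0.symm)
    exact this.not_gt ha.2
  have hAy0 : F A y = 0 := le_antisymm (hnonpos y hy) hAy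
  refine ⟨A, ⟨hmidA, lt_of_le_of_ne hA.2 ?_⟩, y,
    ⟨lt_of_le_of_ne hy.1 ?_, lt_of_le_of_ne hy.2 ?_⟩, hAy0, hnonpos, ?_, ?_⟩
  · rintro rfl
    exact (hnonpos y₁ hy₁).not_gt hpos
  · rintro rfl
    exact (hc A hA).ne hAy0
  · rintro rfl
    exact (hd A hA).ne hAy0
  · intro a ha z hz
    by_contra! h
    exact (hle a ⟨ha.1, ha.2.le.trans hA.2⟩ z hz h).not_gt ha.2
  · intro a ha
    have := hmono y hy hA ⟨hA.1.trans ha.1.le, ha.2⟩ ha.1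
    simp only [hAy0] at this
    exact this

theorem exists_first_threshold :
    ∃ A ∈ Set.Ioo (2.01 : ℝ) 2.011, ∃ y ∈ Set.Ioo (4 : ℝ) 10, scaledQuartic A y = 0 ∧
      (∀ z ∈ Set.Icc (4 : ℝ) 10, scaledQuartic A z ≤ 0) ∧
      (∀ a ∈ Set.Ico 1 A, ∀ z ∈ Set.Icc (4 : ℝ) 10, scaledQuartic a z < 0) ∧
      ∀ a ∈ Set.Ioc A 2.011, 0 < scaledQuartic a y := by
  refine exists_threshold continuous_scaledQuartic (by norm_num) (y₁ := 6) (by norm_num)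
    (fun y hy => strictMonoOn_scaledQuartic fun a ha => ?_)
    (fun y hy => scaledQuartic_two_point_zero_one_neg hy) (fun a ha => ?_) (fun a ha => ?_) ?_
  · exact scaledQuarticDeriv_pos_of_four_le ⟨ha.1, by linarith [ha.2]⟩ hy.1
  · exact scaledQuartic_neg_of_mem_Icc_two_four ⟨ha.1, by linarith [ha.2]⟩ (by norm_num)
  · exact scaledQuartic_neg_of_ten_le ⟨ha.1, by linarith [ha.2]⟩ le_rfl
  · exact scaledQuartic_six_pos (by norm_num)

theorem exists_second_threshold :
    ∃ A ∈ Set.Ioo (4.921 : ℝ) 4.922, ∃ y ∈ Set.Ioo (1.1 : ℝ) 1.2, scaledQuartic A y = 0 ∧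
      (∀ z ∈ Set.Icc (1.1 : ℝ) 1.2, scaledQuartic A z ≤ 0) ∧
      (∀ a ∈ Set.Ico 4.5 A, ∀ z ∈ Set.Icc (1.1 : ℝ) 1.2, scaledQuartic a z < 0) ∧
      ∀ a ∈ Set.Ioc A 4.922, 0 < scaledQuartic a y := by
  refine exists_threshold continuous_scaledQuartic (by norm_num) (y₁ := 29 / 25) (by norm_num)
    (fun y hy => strictMonoOn_scaledQuartic fun a ha => ?_)
    (fun y hy => scaledQuartic_four_point_nine_two_one_neg hy) (fun a ha => ?_)
    (fun a ha => ?_) ?_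
  · norm_num at ha hy
    exact scaledQuarticDeriv_pos_of_mem_Icc ⟨by linarith, by linarith⟩ ⟨by linarith, by linarith⟩
  · norm_num at ha
    exact scaledQuartic_neg_of_le_eleven_tenths ⟨by linarith, by linarith⟩ (by norm_num)
  · norm_num at ha
    exact scaledQuartic_neg_of_le_nine_fifths' ⟨by linarith, by linarith⟩ (by norm_num)
  · exact scaledQuartic_pos_of_le_six (by norm_num)

/-! ### Signs on the assembled regions -/

theorem scaledQuartic_neg_of_pos_le_one {a y : ℝ} (ha : a ∈ Set.Icc (0 : ℝ) 1) (hy : 0 ≤ y) :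
    scaledQuartic a y < 0 := by
  rcases le_total y 1 with h | h
  · exact scaledQuartic_neg_of_le_one ha ⟨hy, h⟩
  · exact scaledQuartic_neg_of_le_one_of_one_le ha h

theorem scaledQuartic_neg_of_le_four {a y : ℝ} (ha : a ∈ Set.Icc (1 : ℝ) 2.02)
    (hy : y ∈ Set.Icc (0 : ℝ) 4) : scaledQuartic a y < 0 := by
  norm_num at ha
  rcases le_total y 2 with h | h
  · exact scaledQuartic_neg_of_le_two ⟨ha.1, by linarith⟩ ⟨hy.1, h⟩
  · exact scaledQuartic_neg_of_mem_Icc_two_four ha ⟨h, hy.2⟩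

theorem scaledQuartic_neg_of_notMem_Icc {a y : ℝ} (ha : a ∈ Set.Icc (2 : ℝ) 4.93)
    (hy : y ∈ Set.Icc (0 : ℝ) 1.8) (h : y ∉ Set.Icc (1.1 : ℝ) 1.2) : scaledQuartic a y < 0 := by
  norm_num at ha hy h
  rcases le_total y (11 / 10) with h1 | h1
  · exact scaledQuartic_neg_of_le_eleven_tenths ha ⟨hy.1, h1⟩
  · rcases le_total a (37 / 10) with h2 | h2
    · exact scaledQuartic_neg_of_le_nine_fifths ⟨ha.1, h2⟩ ⟨(h h1).le, hy.2⟩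
    · exact scaledQuartic_neg_of_le_nine_fifths' ⟨h2, ha.2⟩ ⟨(h h1).le, hy.2⟩

theorem exists_scaledQuartic_neg {a : ℝ} (ha : 2 ≤ a) (b : ℝ) :
    ∃ y > b, scaledQuartic a y < 0 := by
  obtain ⟨y, hyb, hya⟩ : ∃ y, b < y ∧ (a + 1) ^ 4 ≤ y :=
    ⟨max (b + 1) ((a + 1) ^ 4), (lt_add_one b).trans_le (le_max_left _ _), le_max_right _ _⟩
  refine ⟨y, hyb, ?_⟩
  obtain ⟨t, ht, rfl⟩ : ∃ t, 3 ≤ t ∧ a = t - 1 := ⟨a + 1, by linarith, by ring⟩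
  rw [sub_add_cancel] at hya
  have hy1 : 1 ≤ y := (one_le_pow₀ (by linarith : (1 : ℝ) ≤ t)).trans hya
  -- With y ≥ t⁴ the cubic term is at most 2y⁴ and the linear term at most y⁴, so together with -4y⁴
  -- at most -y⁴ remains.
  have hcubic : 2 * (t - 1 - 1) * t ^ 3 * y ^ 3 ≤ 2 * y * y ^ 3 := by
    refine mul_le_mul_of_nonneg_right ?_ (by positivity)
    nlinarith [pow_pos (by linarith : 0 < t) 3]
  have hlinear : (t - 1) * (3 * (t - 1) ^ 2 + 4 * (t - 1) - 1) * t ^ 2 * y ≤ y ^ 3 * y := by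
    gcongr
    have h1 : (t - 1) * (3 * (t - 1) ^ 2 + 4 * (t - 1) - 1) ≤ t ^ 6 := by
      have : 27 * t ^ 3 ≤ t ^ 3 * t ^ 3 := by
        gcongr
        nlinarith [sq_nonneg (t - 3)]
      nlinarith [pow_pos (by linarith : 0 < t) 3, sq_nonneg t]
    calc _ ≤ t ^ 6 * t ^ 2 := by gcongr
      _ = t ^ 4 * t ^ 4 * 1 := by ring
      _ ≤ y * y * y := by gcongr
      _ = y ^ 3 := by ring
  have hrest : 0 ≤ (2 * (t - 1) ^ 5 + 5 * (t - 1) ^ 4 + 6 * (t - 1) ^ 3 + 6 * (t - 1) ^ 2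
      + 8 * (t - 1) + 1) * y ^ 2 + (t ^ 5 + (t - 1) ^ 4 + (t - 1) ^ 2) := by
    have : 0 ≤ t - 1 := by linarith
    positivity
  have : 0 < y ^ 4 := by positivity
  unfold scaledQuartic
  rw [sub_add_cancel]
  linarith

theorem exists_scaledQuartic_pos {a : ℝ} (ha : 2.011 ≤ a) :
    ∃ y > 4, 0 < scaledQuartic a y := by
  rcases le_total a 6 with h | h
  · exact ⟨6, by norm_num, scaledQuartic_six_pos ⟨by norm_num at ha; exact ha, h⟩⟩
  · exact ⟨a, by linarith, scaledQuartic_self_pos h⟩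

theorem exists_scaledQuartic_pos_of_le {a : ℝ} (ha : 4.922 ≤ a) :
    ∃ y ∈ Set.Ioo (0 : ℝ) 1.8, 0 < scaledQuartic a y := by
  rcases le_total a 6 with h | h
  · exact ⟨29 / 25, by norm_num, scaledQuartic_pos_of_le_six ⟨by norm_num at ha; exact ha, h⟩⟩
  · exact ⟨1, by norm_num, scaledQuartic_one_pos h⟩

/-! ### Positive roots, distinct and with multiplicity -/

theorem eval_quarticP (a x : ℝ) : (quarticP a).eval x = scaledQuartic a ((a + 1) * x) := by
  unfold quarticP scaledQuartic
  simp only [eval_add, eval_sub, eval_mul, eval_C, eval_pow, eval_X]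
  ring

theorem natDegree_quarticP {a : ℝ} (ha : 0 < a) : (quarticP a).natDegree = 4 := by
  have : a + 1 ≠ 0 := by positivity
  unfold quarticP
  compute_degree!

theorem quarticP_ne_zero {a : ℝ} (ha : 0 < a) : quarticP a ≠ 0 :=
  ne_zero_of_natDegree_gt (n := 0) (by rw [natDegree_quarticP ha]; norm_num)

theorem numPosRoots_quarticP_le {a : ℝ} (ha : 0 < a) : numPosRoots (quarticP a) ≤ 4 :=
  (Multiset.card_le_card (Multiset.filter_le _ _)).trans
    ((card_roots' _).trans (natDegree_quarticP ha).le)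

theorem numPosRoots_eq_zero {p : ℝ[X]} (h : ∀ x, 0 < x → p.eval x ≠ 0) : numPosRoots p = 0 := by
  rw [numPosRoots, Multiset.card_eq_zero, Multiset.filter_eq_nil]
  exact fun x hx hx0 => h x hx0 (isRoot_of_mem_roots hx)

theorem ncard_pos_roots {p : ℝ[X]} (hp : p ≠ 0) :
    {x : ℝ | 0 < x ∧ p.eval x = 0}.ncard = (p.roots.filter (fun x => 0 < x)).toFinset.card := by
  rw [← Set.ncard_coe_finset]
  congr 1
  ext x
  simp [hp, and_comm]

theorem ncard_pos_roots_le_numPosRoots {p : ℝ[X]} (hp : p ≠ 0) :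
    {x : ℝ | 0 < x ∧ p.eval x = 0}.ncard ≤ numPosRoots p :=
  (ncard_pos_roots hp).trans_le (Multiset.toFinset_card_le _)

theorem card_le_ncard_pos_roots {p : ℝ[X]} (hp : p ≠ 0) (s : Finset ℝ)
    (hs : ∀ x ∈ s, 0 < x ∧ p.eval x = 0) : s.card ≤ {x : ℝ | 0 < x ∧ p.eval x = 0}.ncard := by
  rw [ncard_pos_roots hp]
  refine Finset.card_le_card fun x hx => ?_
  simpa [hp, and_comm] using hs x hx

/-- A multiple positive root raises the number of positive roots above the number of distinct
ones. -/
theorem card_lt_numPosRoots {p : ℝ[X]} (hp : p ≠ 0) (s : Finset ℝ)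
    (hs : ∀ x ∈ s, 0 < x ∧ p.eval x = 0) {x : ℝ} (hx : x ∈ s) (hx' : p.derivative.eval x = 0) :
    s.card < numPosRoots p := by
  have hmult : 1 < p.rootMultiplicity x :=
    (one_lt_rootMultiplicity_iff_isRoot hp).2 ⟨(hs x hx).2, hx'⟩
  -- The set `s` with a second copy of x still fits into the multiset of positive roots.
  have hle : x ::ₘ s.val ≤ p.roots.filter (fun x => 0 < x) := by
    rw [Multiset.le_filter, Multiset.le_iff_count]
    refine ⟨fun y => ?_, fun y hy => ?_⟩
    · rw [count_roots]
      rcases eq_or_ne y x with rfl | hyx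
      · rw [Multiset.count_cons_self, Multiset.count_eq_one_of_mem s.nodup hx]
        exact hmult
      · rw [Multiset.count_cons_of_ne hyx]
        by_cases hy : y ∈ s.val
        · rw [Multiset.count_eq_one_of_mem s.nodup hy]
          exact (rootMultiplicity_pos hp).2 (hs y hy).2
        · rw [Multiset.count_eq_zero_of_notMem hy]
          exact Nat.zero_le _
    · rcases Multiset.mem_cons.1 hy with rfl | hy
      · exact (hs y hx).1
      · exact (hs y hy).1
  have := Multiset.card_le_card hle
  rwa [Multiset.card_cons] at this

/-! ### At most two roots between the thresholds -/

/-- A quartic with three positive roots, negative leading and negative constant coefficient has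
coefficients of alternating signs. -/
theorem alternating_of_three_pos_roots {q₀ q₁ q₂ q₃ q₄ s₁ s₂ s₃ α β : ℝ}
    (h : ∀ z, q₄ * z ^ 4 + q₃ * z ^ 3 + q₂ * z ^ 2 + q₁ * z + q₀ =
      (z - s₁) * (z - s₂) * (z - s₃) * (α * z + β))
    (h₁ : 0 < s₁) (h₂ : 0 < s₂) (h₃ : 0 < s₃) (hq₄ : q₄ < 0) (hq₀ : q₀ < 0) :
    0 < q₁ ∧ q₂ < 0 := by
  -- Coefficients are compared by finite differences of `h` at 0, ±1, ±2. The signs of q₄ and q₀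
  -- give α < 0 < β, after which every term of q₁ and q₂ has a definite sign.
  have e0 : q₀ = -(s₁ * s₂ * s₃ * β) := by linear_combination h 0
  have e4 : q₄ = α := by
    linear_combination (h 2 + h (-2) - 4 * h 1 - 4 * h (-1) + 6 * h 0) / 24
  have e1 : q₁ = (s₁ * s₂ + s₁ * s₃ + s₂ * s₃) * β - s₁ * s₂ * s₃ * α := by
    linear_combination (8 * h 1 - 8 * h (-1) - h 2 + h (-2)) / 12
  have e2 : q₂ = (s₁ * s₂ + s₁ * s₃ + s₂ * s₃) * α - (s₁ + s₂ + s₃) * β := by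
    linear_combination (16 * h 1 + 16 * h (-1) - 30 * h 0 - h 2 - h (-2)) / 24
  have hα : α < 0 := e4 ▸ hq₄
  have hβ : 0 < β := by
    by_contra! hβ
    have : s₁ * s₂ * s₃ * β ≤ 0 := mul_nonpos_of_nonneg_of_nonpos (by positivity) hβ
    linarith
  have hα' : 0 < -α := by linarith
  have p1 : 0 < s₁ * s₂ * s₃ * (-α) := by positivity
  have p2 : 0 < (s₁ * s₂ + s₁ * s₃ + s₂ * s₃) * (-α) := by positivity
  have p3 : 0 < (s₁ * s₂ + s₁ * s₃ + s₂ * s₃) * β := by positivity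
  have p4 : 0 < (s₁ + s₂ + s₃) * β := by positivity
  constructor <;> linarith

theorem exists_factorization_of_two_lt_numPosRoots {p : ℝ[X]} (hdeg : p.natDegree = 4)
    (h : 2 < numPosRoots p) :
    ∃ r₁ r₂ r₃ α β : ℝ, 0 < r₁ ∧ 0 < r₂ ∧ 0 < r₃ ∧
      ∀ x, p.eval x = (x - r₁) * (x - r₂) * (x - r₃) * (α * x + β) := by
  have hp : p ≠ 0 := ne_zero_of_natDegree_gt (n := 0) (by omega)
  obtain ⟨s, hs⟩ : ∃ s, s ∈ (p.roots.filter (fun x => 0 < x)).powersetCard 3 := by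
    refine Multiset.card_pos_iff_exists_mem.1 ?_
    rw [Multiset.card_powersetCard]
    exact Nat.choose_pos h
  obtain ⟨hle, hcard⟩ := Multiset.mem_powersetCard.1 hs
  obtain ⟨hle, hpos⟩ := Multiset.le_filter.1 hle
  obtain ⟨r₁, r₂, r₃, rfl⟩ := Multiset.card_eq_three.1 hcard
  obtain ⟨q, hq⟩ := (Multiset.prod_X_sub_C_dvd_iff_le_roots hp _).2 hle
  have hq' : p = (X - C r₁) * (X - C r₂) * (X - C r₃) * q := by
    rw [hq]
    simp [mul_assoc]
  have hmonic : ((X - C r₁) * (X - C r₂) * (X - C r₃)).Monic :=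
    ((monic_X_sub_C r₁).mul (monic_X_sub_C r₂)).mul (monic_X_sub_C r₃)
  have hq0 : q ≠ 0 := by
    rintro rfl
    exact hp (by rw [hq', mul_zero])
  have hqdeg : q.natDegree ≤ 1 := by
    have h3 : ((X - C r₁) * (X - C r₂) * (X - C r₃)).natDegree = 3 := by
      compute_degree!
    rw [hq', hmonic.natDegree_mul' hq0, h3] at hdeg
    omega
  obtain ⟨α, β, rfl⟩ := exists_eq_X_add_C_of_natDegree_le_one hqdeg
  refine ⟨r₁, r₂, r₃, α, β, hpos _ (by simp), hpos _ (by simp), hpos _ (by simp), fun x => ?_⟩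
  rw [hq']
  simp

theorem scaledQuartic_shift (a z : ℝ) :
    scaledQuartic a (9 / 5 + z) = -4 * z ^ 4 + shiftedCubicCoeff a * z ^ 3
      + shiftedQuadraticCoeff a * z ^ 2 + shiftedLinearCoeff a * z + scaledQuartic a (9 / 5) := by
  unfold scaledQuartic shiftedCubicCoeff shiftedQuadraticCoeff shiftedLinearCoeff
  ring

/-- At the origin the coefficients alternate, so sign counting says nothing there. Since all
positive zeros lie beyond 9/5, it may be applied at 9/5 instead, where alternation fails: the linear
coefficient is negative for a near either end of the range and the quadratic one is positive in the
middle. -/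
theorem numPosRoots_quarticP_le_two {a : ℝ} (ha : a ∈ Set.Icc (2 : ℝ) 4.93)
    (hneg : ∀ y ∈ Set.Icc (0 : ℝ) 1.8, scaledQuartic a y < 0) :
    numPosRoots (quarticP a) ≤ 2 := by
  norm_num at ha hneg
  have ha0 : 0 < a := by linarith
  by_contra! h
  obtain ⟨r₁, r₂, r₃, α, β, h₁, h₂, h₃, hfac⟩ :=
    exists_factorization_of_two_lt_numPosRoots (natDegree_quarticP ha0) h
  have hbig : ∀ r, 0 < r → (quarticP a).eval r = 0 → 0 < (a + 1) * r - 9 / 5 := by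
    intro r hr hr0
    rw [eval_quarticP] at hr0
    by_contra! hle
    exact (hneg _ (by positivity) (by linarith)).ne hr0
  -- For x = (9/5 + z)/(a + 1) each of the four linear factors contributes one denominator a + 1;
  -- all four are absorbed into α and β.
  have key := alternating_of_three_pos_roots (q₀ := scaledQuartic a (9 / 5))
    (q₁ := shiftedLinearCoeff a) (q₂ := shiftedQuadraticCoeff a) (q₃ := shiftedCubicCoeff a)
    (q₄ := -4) (α := α / (a + 1) ^ 4) (β := (α * (9 / 5) + β * (a + 1)) / (a + 1) ^ 4)
    (fun z => ?_) (hbig r₁ h₁ (by rw [hfac]; ring)) (hbig r₂ h₂ (by rw [hfac]; ring))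
    (hbig r₃ h₃ (by rw [hfac]; ring)) (by norm_num) (hneg _ (by norm_num) le_rfl)
  · rcases le_total a (11 / 5) with h5 | h5
    · exact key.1.not_gt (shiftedLinearCoeff_neg_of_le ⟨ha.1, h5⟩)
    · rcases le_total a (37 / 10) with h6 | h6
      · exact key.2.not_gt (shiftedQuadraticCoeff_pos ⟨h5, h6⟩)
      · exact key.1.not_gt (shiftedLinearCoeff_neg_of_ge ⟨h6, ha.2⟩)
  · have hx := hfac ((9 / 5 + z) / (a + 1))
    rw [eval_quarticP, mul_div_cancel₀ _ (by positivity), scaledQuartic_shift] at hx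
    rw [hx]
    field_simp
    ring

/-! ### Lower bounds for the number of roots -/

/-- An interior maximum of `scaledQuartic a` gives a critical point of `quarticP a`. -/
theorem eval_derivative_quarticP_eq_zero {a c d y : ℝ} (ha : 0 < a) (hy : y ∈ Set.Ioo c d)
    (hmax : ∀ z ∈ Set.Icc c d, scaledQuartic a z ≤ scaledQuartic a y) :
    (quarticP a).derivative.eval (y / (a + 1)) = 0 := by
  rw [← Polynomial.deriv]
  refine IsLocalMax.deriv_eq_zero ?_
  have hy' : (a + 1) * (y / (a + 1)) = y := mul_div_cancel₀ _ (by positivity)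
  have hcont : Continuous fun x : ℝ => (a + 1) * x := by fun_prop
  have hmem : Set.Ioo c d ∈ nhds ((a + 1) * (y / (a + 1))) := by
    rw [hy']
    exact Ioo_mem_nhds hy.1 hy.2
  filter_upwards [hcont.continuousAt.preimage_mem_nhds hmem] with x hx
  rw [eval_quarticP, eval_quarticP, hy']
  exact hmax _ ⟨hx.1.le, hx.2.le⟩

theorem continuous_scaledQuartic_right (a : ℝ) : Continuous (scaledQuartic a) := by
  unfold scaledQuartic
  fun_prop

theorem exists_zero_of_neg_pos {a y z : ℝ} (hyz : y ≤ z) (hy : scaledQuartic a y < 0)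
    (hz : 0 < scaledQuartic a z) : ∃ t ∈ Set.Ioo y z, scaledQuartic a t = 0 :=
  intermediate_value_Ioo hyz (continuous_scaledQuartic_right a).continuousOn ⟨hy, hz⟩

theorem exists_zero_of_pos_neg {a y z : ℝ} (hyz : y ≤ z) (hy : 0 < scaledQuartic a y)
    (hz : scaledQuartic a z < 0) : ∃ t ∈ Set.Ioo y z, scaledQuartic a t = 0 :=
  intermediate_value_Ioo' hyz (continuous_scaledQuartic_right a).continuousOn ⟨hz, hy⟩

theorem scaledQuartic_zero_neg {a : ℝ} (ha : 0 < a) : scaledQuartic a 0 < 0 := by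
  have : 0 < (a + 1) ^ 5 + a ^ 4 + a ^ 2 := by positivity
  unfold scaledQuartic
  linarith

/-- Positive zeros of `scaledQuartic a` are positive roots of `quarticP a`, up to scaling. -/
theorem exists_finset_pos_roots {a : ℝ} (ha : 0 < a) (s : Finset ℝ)
    (hs : ∀ y ∈ s, 0 < y ∧ scaledQuartic a y = 0) :
    ∃ t : Finset ℝ, t.card = s.card ∧ (∀ x ∈ t, 0 < x ∧ (quarticP a).eval x = 0) ∧
      ∀ y ∈ s, y / (a + 1) ∈ t := by
  have ha1 : 0 < a + 1 := by linarith
  refine ⟨s.image fun y => y / (a + 1),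
    Finset.card_image_of_injective _ (fun _ _ h => (div_left_inj' ha1.ne').1 h), ?_,
    fun y hy => Finset.mem_image_of_mem _ hy⟩
  intro x hx
  obtain ⟨y, hy, rfl⟩ := Finset.mem_image.1 hx
  rw [eval_quarticP, mul_div_cancel₀ _ ha1.ne']
  exact ⟨div_pos (hs y hy).1 ha1, (hs y hy).2⟩

theorem le_ncard_pos_roots_quarticP {a : ℝ} (ha : 0 < a) (s : Finset ℝ)
    (hs : ∀ y ∈ s, 0 < y ∧ scaledQuartic a y = 0) :
    s.card ≤ {x : ℝ | 0 < x ∧ (quarticP a).eval x = 0}.ncard := by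
  obtain ⟨t, htc, ht, -⟩ := exists_finset_pos_roots ha s hs
  exact htc ▸ card_le_ncard_pos_roots (quarticP_ne_zero ha) t ht

/-- A zero that is also an interior maximum is a critical point, hence a multiple root. This handles
a = A₁ and a = A₂. -/
theorem lt_numPosRoots_quarticP {a c d y : ℝ} (ha : 0 < a) (s : Finset ℝ)
    (hs : ∀ y ∈ s, 0 < y ∧ scaledQuartic a y = 0) (hys : y ∈ s) (hy : y ∈ Set.Ioo c d)
    (hmax : ∀ z ∈ Set.Icc c d, scaledQuartic a z ≤ 0) :
    s.card < numPosRoots (quarticP a) := by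
  obtain ⟨t, htc, ht, hst⟩ := exists_finset_pos_roots ha s hs
  rw [← htc]
  refine card_lt_numPosRoots (quarticP_ne_zero ha) t ht (hst y hys)
    (eval_derivative_quarticP_eq_zero ha hy ?_)
  rwa [(hs y hys).2]

theorem exists_two_zeros {a : ℝ} (ha : 2 ≤ a) {b y : ℝ} (hby : b ≤ y)
    (hb : scaledQuartic a b < 0) (hy : 0 < scaledQuartic a y) :
    ∃ s t, b < s ∧ s < t ∧ scaledQuartic a s = 0 ∧ scaledQuartic a t = 0 := by
  obtain ⟨z, hz, hz'⟩ := exists_scaledQuartic_neg ha y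
  obtain ⟨s, hs, hs0⟩ := exists_zero_of_neg_pos hby hb hy
  obtain ⟨t, ht, ht0⟩ := exists_zero_of_pos_neg (le_of_lt hz) hy hz'
  exact ⟨s, t, hs.1, hs.2.trans ht.1, hs0, ht0⟩

/-! ### Proof of the theorem -/

theorem quarticF_eq (a : ℝ) : quarticF a a 3 = C ((a - 1) ^ 2) * quarticP a := by
  refine funext fun x => ?_
  unfold quarticF quarticP coeffA coeffB coeffC coeffD coeffE
  simp only [eval_add, eval_sub, eval_mul, eval_C, eval_pow, eval_X]
  ring

theorem eval_quarticP_ne_zero {a : ℝ} (ha : 0 < a) (h : ∀ y, 0 ≤ y → scaledQuartic a y < 0)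
    (x : ℝ) (hx : 0 < x) : (quarticP a).eval x ≠ 0 := by
  rw [eval_quarticP]
  exact (h _ (by positivity)).ne

theorem lemma1 :
    (∀ a : ℝ, quarticF a a 3 = C ((a - 1) ^ 2) * quarticP a) ∧
    ∃ A₁ A₂ : ℝ,
      (2.010 ≤ A₁ ∧ A₁ < 2.011) ∧ (4.921 ≤ A₂ ∧ A₂ < 4.922) ∧
      (∀ a : ℝ, 0 < a → a < A₁ → numPosRoots (quarticP a) = 0) ∧
      (∀ a : ℝ, A₁ ≤ a → a < A₂ → numPosRoots (quarticP a) = 2) ∧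
      (∀ a : ℝ, A₂ ≤ a → numPosRoots (quarticP a) = 4) ∧
      (∀ a : ℝ, 0 < a → a ≠ A₁ → a ≠ A₂ →
        {x : ℝ | 0 < x ∧ (quarticP a).eval x = 0}.ncard = numPosRoots (quarticP a)) := by
  refine ⟨quarticF_eq, ?_⟩
  obtain ⟨A₁, ⟨hA₁, hA₁'⟩, y₁, ⟨hy₁, hy₁'⟩, hzero₁, hmax₁, hbelow₁, habove₁⟩ :=
    exists_first_threshold
  obtain ⟨A₂, ⟨hA₂, hA₂'⟩, y₂, ⟨hy₂, hy₂'⟩, hzero₂, hmax₂, hbelow₂, habove₂⟩ :=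
    exists_second_threshold
  norm_num at hA₁ hA₁' hA₂ hA₂' hy₂ hy₂' hbelow₂ hmax₂ habove₁ habove₂
  -- below the first threshold there are no zeros at all
  have hnone : ∀ a, 0 < a → a < A₁ → ∀ y, 0 ≤ y → scaledQuartic a y < 0 := by
    intro a ha haA y hy
    rcases le_total a 1 with h1 | h1
    · exact scaledQuartic_neg_of_pos_le_one ⟨ha.le, h1⟩ hy
    · have ha2 : a ≤ 101 / 50 := by linarith
      rcases le_total y 4 with h4 | h4
      · exact scaledQuartic_neg_of_le_four ⟨h1, by norm_num; exact ha2⟩ ⟨hy, h4⟩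
      · rcases le_total y 10 with h10 | h10
        · exact hbelow₁ a ⟨h1, haA⟩ y ⟨h4, h10⟩
        · exact scaledQuartic_neg_of_ten_le ⟨h1, ha2⟩ h10
  -- below the second threshold all zeros exceed `9 / 5`
  have hsmall : ∀ a, 2 ≤ a → a < A₂ → ∀ y ∈ Set.Icc (0 : ℝ) 1.8, scaledQuartic a y < 0 := by
    intro a ha haA y hy
    by_cases hmem : y ∈ Set.Icc (1.1 : ℝ) 1.2
    · norm_num at hmem
      rcases le_total a (9 / 2) with h | h
      · exact scaledQuartic_neg_of_le_six_fifths ⟨ha, h⟩ hmem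
      · exact hbelow₂ a h haA y hmem.1 hmem.2
    · exact scaledQuartic_neg_of_notMem_Icc ⟨ha, by norm_num; linarith⟩ hy hmem
  have hle_two : ∀ a, 2 ≤ a → a < A₂ → numPosRoots (quarticP a) ≤ 2 := fun a ha haA =>
    numPosRoots_quarticP_le_two ⟨ha, by norm_num; linarith⟩ (hsmall a ha haA)
  -- Up to 2.011, monotonicity in a makes G positive at the touching point y₁; beyond that, explicit
  -- points serve.
  have hbig : ∀ a, A₁ < a → ∃ y > 4, 0 < scaledQuartic a y := by
    intro a ha
    rcases le_total a 2.011 with h | h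
    · norm_num at h
      exact ⟨y₁, hy₁, habove₁ a ha h⟩
    · exact exists_scaledQuartic_pos h
  have htwo : ∀ a, A₁ < a → a < A₂ →
      2 ≤ {x : ℝ | 0 < x ∧ (quarticP a).eval x = 0}.ncard := by
    intro a ha haA
    have ha2 : 2 ≤ a := by linarith
    obtain ⟨y, hy, hpos⟩ := hbig a ha
    obtain ⟨s, t, hs, hst, hs0, ht0⟩ := exists_two_zeros ha2 (by linarith : 0 ≤ y)
      (scaledQuartic_zero_neg (by linarith)) hpos
    rw [← Finset.card_pair hst.ne]
    refine le_ncard_pos_roots_quarticP (by linarith) _ fun x hx => ?_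
    rcases Finset.mem_insert.1 hx with rfl | hx
    · exact ⟨hs, hs0⟩
    · rw [Finset.mem_singleton.1 hx]
      exact ⟨hs.trans hst, ht0⟩
  have hupper : ∀ a, A₂ ≤ a → ∃ s t, 9 / 5 < s ∧ s < t ∧
      scaledQuartic a s = 0 ∧ scaledQuartic a t = 0 := by
    intro a ha
    obtain ⟨y, hy, hpos⟩ := hbig a (by linarith)
    exact exists_two_zeros (by linarith) (by linarith)
      (scaledQuartic_nine_fifths_neg (by linarith)) hpos
  have hfour : ∀ a, A₂ < a → 4 ≤ {x : ℝ | 0 < x ∧ (quarticP a).eval x = 0}.ncard := by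
    intro a ha
    have ha0 : 0 < a := by linarith
    obtain ⟨y, hy, hy', hpos⟩ : ∃ y, 0 ≤ y ∧ y ≤ 9 / 5 ∧ 0 < scaledQuartic a y := by
      rcases le_total a 4.922 with h | h
      · norm_num at h
        exact ⟨y₂, by linarith, by linarith, habove₂ a ha h⟩
      · obtain ⟨y, hy, hpos⟩ := exists_scaledQuartic_pos_of_le h
        norm_num at hy
        exact ⟨y, hy.1.le, hy.2.le, hpos⟩
    obtain ⟨p, hp, hp0⟩ := exists_zero_of_neg_pos hy (scaledQuartic_zero_neg ha0) hpos
    obtain ⟨q, hq, hq0⟩ := exists_zero_of_pos_neg hy' hpos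
      (scaledQuartic_nine_fifths_neg (by linarith))
    obtain ⟨s, t, hs, hst, hs0, ht0⟩ := hupper a ha.le
    have hpq := hp.2.trans hq.1
    have hqs := hq.2.trans hs
    have hcard : ({p, q, s, t} : Finset ℝ).card = 4 := by
      rw [Finset.card_insert_of_notMem, Finset.card_insert_of_notMem, Finset.card_pair hst.ne]
      · simp only [Finset.mem_insert, Finset.mem_singleton, not_or]
        exact ⟨hqs.ne, (hqs.trans hst).ne⟩
      · simp only [Finset.mem_insert, Finset.mem_singleton, not_or]
        exact ⟨hpq.ne, (hpq.trans hqs).ne, (hpq.trans (hqs.trans hst)).ne⟩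
    rw [← hcard]
    refine le_ncard_pos_roots_quarticP ha0 _ fun x hx => ?_
    simp only [Finset.mem_insert, Finset.mem_singleton] at hx
    rcases hx with rfl | rfl | rfl | rfl
    · exact ⟨hp.1, hp0⟩
    · exact ⟨hp.1.trans hpq, hq0⟩
    · exact ⟨by linarith, hs0⟩
    · exact ⟨by linarith, ht0⟩
  have hcount_two : ∀ a, A₁ ≤ a → a < A₂ → numPosRoots (quarticP a) = 2 := by
    intro a ha haA
    have ha2 : 2 ≤ a := by linarith
    refine le_antisymm (hle_two a ha2 haA) ?_
    rcases ha.eq_or_lt with rfl | ha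
    -- At a = A₁ the single zero y₁ counts at least twice.
    · refine lt_numPosRoots_quarticP (by linarith) {y₁} (fun y hy => ?_)
        (Finset.mem_singleton_self y₁) ⟨hy₁, hy₁'⟩ hmax₁
      rw [Finset.mem_singleton.1 hy]
      exact ⟨by linarith, hzero₁⟩
    · exact (htwo a ha haA).trans
        (ncard_pos_roots_le_numPosRoots (quarticP_ne_zero (by linarith)))
  have hcount_four : ∀ a, A₂ ≤ a → numPosRoots (quarticP a) = 4 := by
    intro a ha
    refine le_antisymm (numPosRoots_quarticP_le (by linarith)) ?_
    rcases ha.eq_or_lt with rfl | ha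
    -- At a = A₂ there are three distinct zeros, of which y₂ is multiple.
    · obtain ⟨s, t, hs, hst, hs0, ht0⟩ := hupper A₂ le_rfl
      have hcard : ({y₂, s, t} : Finset ℝ).card = 3 :=
        Finset.card_eq_three.2 ⟨y₂, s, t, (by linarith : y₂ < s).ne, (by linarith : y₂ < t).ne, hst.ne, rfl⟩
      have := lt_numPosRoots_quarticP (a := A₂) (c := 11 / 10) (d := 6 / 5) (y := y₂)
        (by linarith) {y₂, s, t} (fun y hy => ?_) (by simp) ⟨hy₂, hy₂'⟩
        (fun z hz => hmax₂ z hz.1 hz.2)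
      · rwa [hcard] at this
      · simp only [Finset.mem_insert, Finset.mem_singleton] at hy
        rcases hy with rfl | rfl | rfl
        · exact ⟨by linarith, hzero₂⟩
        · exact ⟨by linarith, hs0⟩
        · exact ⟨by linarith, ht0⟩
    · exact (hfour a ha).trans
        (ncard_pos_roots_le_numPosRoots (quarticP_ne_zero (by linarith)))
  refine ⟨A₁, A₂, ⟨by norm_num; exact hA₁.le, by norm_num; exact hA₁'⟩,
    ⟨by norm_num; exact hA₂.le, by norm_num; exact hA₂'⟩, fun a ha haA => ?_, hcount_two,
    hcount_four, fun a ha hne₁ hne₂ => ?_⟩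
  · exact numPosRoots_eq_zero (eval_quarticP_ne_zero ha (hnone a ha haA))
  · refine le_antisymm (ncard_pos_roots_le_numPosRoots (quarticP_ne_zero ha)) ?_
    rcases lt_or_gt_of_ne hne₁ with h₁ | h₁
    · rw [numPosRoots_eq_zero (eval_quarticP_ne_zero ha (hnone a ha h₁))]
      exact Nat.zero_le _
    · rcases lt_or_gt_of_ne hne₂ with h₂ | h₂
      · rw [hcount_two a h₁.le h₂]
        exact htwo a h₁ h₂
      · rw [hcount_four a h₂.le]
        exact hfour a h₂
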